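/- **Setting.** Let $K$ be a field of characteristic $0$ (for instance $\mathbb C$). Let $\psi_k,\psi_k^*$ ($k\in\mathbb Z$) be the free fermions, $[\psi_j,\psi_k^*]_+=\delta_{jk}$, $[\psi_j,\psi_k]_+=[\psi_j^*,\psi_k^*]_+=0$, acting on the fermionic Fock space over $K$ with vacuum $|0\rangle$, where $\psi_k|0\rangle=0$ for $k<0$ and $\psi_k^*|0\rangle=0$ for $k\ge 0$. The charged vacua are $|n\rangle=\psi_{n-1}\cdots\psi_0|0\rangle$ for $n>0$ and $|n\rangle=\psi^*_{n}\cdots\psi^*_{-1}|0\rangle$ for $n<0$, and $\langle n|$ is the dual vacuum, normalized by $\langle n|n\rangle=1$. For a function $r:\mathbb Z\to K$ and $m\ge 1$ put $$H_m=\sum_{k\in\mathbb Z}\psi_k\psi^*_{k+m},\qquad A_m=-\sum_{k\in\mathbb Z}r(k)r(k-1)\cdots r(k-m+1)\,\psi_k\psi^*_{k-m}.$$ For $n\in\mathbb Z$ and two sequences of times $\mathbf t=(t_1,t_2,\dots)$, $\mathbf t^*=(t_1^*,t_2^*,\dots)$ the hypergeometric tau function is the formal power series $$\tau_r(n,\mathbf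 t,\mathbf t^*)=\langle n|\,e^{\sum_{m\ge1}t_mH_m}\,e^{-\sum_{m\ge1}t^*_mA_m}\,|n\rangle .$$ For a positive integer $p$ let $\mathbf t^{[p]}$ be the sequence of times with $t^{[p]}_{pk}=t_k$ for $k\ge 1$ and $t^{[p]}_m=0$ if $p\nmid m$; define $\mathbf t^{*[p]}$ in the same way from $\mathbf t^*$. Put $R(k)=r(k)r(k-1)\cdots r(k-p+1)$ and $$r^{(m)}(k)=R(kp+m-1),\qquad m=1,\dots,p,\quad k\in\mathbb Z.$$ **Proposition.** Let $r:\mathbb Z\to K$ be any function, $p$ a positive integer, $n\in\mathbb Z$ and $i\in\{1,\dots,p\}$. Then, as formal power series in the independent indeterminates $t_1,t_2,\dots,t_1^*,t_2^*,\dots$, $$\tau_r\big(np+i,\mathbf t^{[p]},\mathbf t^{*[p]}\big)=\prod_{m=1}^{i}\tau_{r^{(m)}}(n+1,\mathbf t,\mathbf t^*)\;\prod_{m=i+1}^{p}\tau_{r^{(m)}}(n,\mathbf t,\mathbf t^*).$$ -/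

import Mathlib

noncomputable section

namespace HypTau

/-! ### Charged free fermions on the semi-infinite wedge space -/

/-- A Maya diagram: a set of integers (the occupied modes) that contains all sufficiently
negative integers and no sufficiently large one. It stands for the semi-infinite wedge
`s₁ ∧ s₂ ∧ ⋯`, where `s₁ > s₂ > ⋯` are the occupied modes. -/
@[ext]
structure Maya where
  carrier : Set ℤ
  below : ∃ a : ℤ, ∀ k < a, k ∈ carrier
  above : ∃ b : ℤ, ∀ k ∈ carrier, k < b

namespace Maya

/-- Occupy the mode `k`. -/
def fill (S : Maya) (k : ℤ) : Maya where
  carrier := insert k S.carrier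
  below := by
    obtain ⟨a, ha⟩ := S.below
    exact ⟨a, fun j hj => Set.mem_insert_of_mem _ (ha j hj)⟩
  above := by
    obtain ⟨b, hb⟩ := S.above
    refine ⟨max b (k + 1), ?_⟩
    rintro j (rfl | hj)
    · exact lt_max_of_lt_right (by lia)
    · exact lt_max_of_lt_left (hb j hj)

/-- Empty the mode `k`. -/
def clear (S : Maya) (k : ℤ) : Maya where
  carrier := S.carrier \ {k}
  below := by
    obtain ⟨a, ha⟩ := S.below
    exact ⟨min a k, fun j hj => ⟨ha j (by lia), by simp; lia⟩⟩
  above := by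
    obtain ⟨b, hb⟩ := S.above
    exact ⟨b, fun j hj => hb j hj.1⟩

/-- The number of occupied modes above `k`. -/
def numAbove (S : Maya) (k : ℤ) : ℕ := {j ∈ S.carrier | k < j}.ncard

theorem finite_above (S : Maya) (k : ℤ) : {j ∈ S.carrier | k < j}.Finite := by
  obtain ⟨b, hb⟩ := S.above
  exact (Set.finite_Ioo k b).subset fun j hj => ⟨hj.2, hb j hj.1⟩

theorem numAbove_fill (S : Maya) {k : ℤ} (hk : k ∉ S.carrier) (j : ℤ) :
    (S.fill k).numAbove j = S.numAbove j + if j < k then 1 else 0 := by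
  unfold numAbove
  split_ifs with h
  · have : {i ∈ (S.fill k).carrier | j < i} = insert k {i ∈ S.carrier | j < i} := by
      ext i; simp only [fill, Set.mem_insert_iff, Set.mem_ofPred_eq]; grind
    rw [this, Set.ncard_insert_of_notMem (fun h' => hk h'.1) (S.finite_above j)]
  · have : {i ∈ (S.fill k).carrier | j < i} = {i ∈ S.carrier | j < i} := by
      ext i; simp only [fill, Set.mem_insert_iff, Set.mem_ofPred_eq]; grind
    rw [this, add_zero]

theorem numAbove_clear (S : Maya) {k : ℤ} (hk : k ∈ S.carrier) (j : ℤ) :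
    (S.clear k).numAbove j + (if j < k then 1 else 0) = S.numAbove j := by
  have h : (S.clear k).fill k = S := by ext i; simp only [fill, clear]; grind
  conv_rhs => rw [← h]
  rw [numAbove_fill _ (by simp [clear])]

/-- The Maya diagram of the vacuum of charge `n`: exactly the modes `j < n` are occupied. -/
def vac (n : ℤ) : Maya where
  carrier := Set.Iio n
  below := ⟨n, fun _ hk => hk⟩
  above := ⟨n, fun _ hk => hk⟩

end Maya

/-- The fermionic Fock space: finite linear combinations of semi-infinite wedges. -/
abbrev Fock (K : Type*) [Field K] : Type _ := Maya →₀ K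

section Operators

variable (K : Type*) [Field K]

open Classical in
/-- The fermion `ψ_k`: exterior multiplication by the mode `k` from the left. -/
def psi (k : ℤ) : Module.End K (Fock K) :=
  Finsupp.linearCombination K fun S : Maya =>
    if k ∈ S.carrier then 0 else Finsupp.single (S.fill k) ((-1) ^ S.numAbove k)

open Classical in
/-- The fermion `ψ*_k`: contraction with the mode `k`. -/
def psiStar (k : ℤ) : Module.End K (Fock K) :=
  Finsupp.linearCombination K fun S : Maya =>
    if k ∈ S.carrier then Finsupp.single (S.clear k) ((-1) ^ S.numAbove k) else 0

/-- The vacuum vector `|n⟩` of charge `n`. -/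
def ket (n : ℤ) : Fock K := Finsupp.single (Maya.vac n) 1

/-- The dual vacuum `⟨n|`: the coefficient of `|n⟩`. -/
def bra (n : ℤ) : Fock K →ₗ[K] K := Finsupp.lapply (Maya.vac n)

variable {K}

/-- The operator `∑_{k ∈ ℤ} c(k) ψ_k ψ*_{k+m}`, for `m ≠ 0`. On every wedge only finitely many
terms of the sum are nonzero, see `finite_support_bilinear`. -/
def bilinear (c : ℤ → K) (m : ℤ) : Module.End K (Fock K) :=
  Finsupp.linearCombination K fun S : Maya =>
    ∑ᶠ k : ℤ, c k • psi K k (psiStar K (k + m) (Finsupp.single S 1))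

variable (K) in
/-- `H_m = ∑_k ψ_k ψ*_{k+m}`. -/
def opH (m : ℕ+) : Module.End K (Fock K) := bilinear (fun _ => (1 : K)) (m : ℤ)

/-- `A_m = -∑_k r(k) r(k-1) ⋯ r(k-m+1) ψ_k ψ*_{k-m}`. -/
def opA (r : ℤ → K) (m : ℕ+) : Module.End K (Fock K) :=
  -bilinear (fun k => ∏ j ∈ Finset.range (m : ℕ), r (k - j)) (-(m : ℤ))

/-! Consistency checks: the defining relations of the fermions and of the vacua. -/

open Classical in
theorem psi_single (k : ℤ) (S : Maya) (a : K) :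
    psi K k (Finsupp.single S a) =
      if k ∈ S.carrier then 0 else Finsupp.single (S.fill k) (a * (-1) ^ S.numAbove k) := by
  rw [psi, Finsupp.linearCombination_single]
  split_ifs <;> simp

open Classical in
theorem psiStar_single (k : ℤ) (S : Maya) (a : K) :
    psiStar K k (Finsupp.single S a) =
      if k ∈ S.carrier then Finsupp.single (S.clear k) (a * (-1) ^ S.numAbove k) else 0 := by
  rw [psiStar, Finsupp.linearCombination_single]
  split_ifs <;> simp

theorem finite_support_bilinear (c : ℤ → K) {m : ℤ} (hm : m ≠ 0) (S : Maya) :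
    {k : ℤ | c k • psi K k (psiStar K (k + m) (Finsupp.single S 1)) ≠ 0}.Finite := by
  obtain ⟨a, ha⟩ := S.below
  obtain ⟨b, hb⟩ := S.above
  refine (Set.finite_Ico a (b - m)).subset fun k hk => ?_
  rw [Set.mem_ofPred_eq, psiStar_single] at hk
  split_ifs at hk with h
  · rw [psi_single] at hk
    split_ifs at hk with h'
    · simp at hk
    · refine ⟨not_lt.1 fun hlt => h' ⟨ha k hlt, by simpa using hm⟩, ?_⟩
      have := hb _ h
      lia
  · simp at hk

theorem psi_anticomm_psi (j k : ℤ) : psi K j * psi K k + psi K k * psi K j = 0 := by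
  classical
  refine Finsupp.lhom_ext fun S a => ?_
  have hc : (S.fill k).fill j = (S.fill j).fill k := by
    ext i; simp only [Maya.fill, Set.mem_insert_iff]; grind
  have hm (i l : ℤ) : l ∈ (S.fill i).carrier ↔ l = i ∨ l ∈ S.carrier := Iff.rfl
  by_cases hj : j ∈ S.carrier <;> by_cases hk : k ∈ S.carrier <;>
    simp only [LinearMap.add_apply, Module.End.mul_apply, psi_single, hj, hk, hm, if_true,
      if_false, map_zero, or_true, or_false, add_zero, LinearMap.zero_apply]
  rcases lt_trichotomy j k with h | rfl | h
  · simp [h.ne, h.ne', hc, S.numAbove_fill hj, S.numAbove_fill hk, h, h.not_gt,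
      ← Finsupp.single_add, -Finsupp.single_mul]
    ring
  · simp
  · simp [h.ne, h.ne', hc, S.numAbove_fill hj, S.numAbove_fill hk, h, h.not_gt,
      ← Finsupp.single_add, -Finsupp.single_mul]
    ring

theorem psiStar_anticomm_psiStar (j k : ℤ) :
    psiStar K j * psiStar K k + psiStar K k * psiStar K j = 0 := by
  classical
  refine Finsupp.lhom_ext fun S a => ?_
  have hc : (S.clear k).clear j = (S.clear j).clear k := by
    ext i; simp only [Maya.clear]; grind
  have hm (i l : ℤ) : l ∈ (S.clear i).carrier ↔ l ∈ S.carrier ∧ l ≠ i := Iff.rfl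
  by_cases hj : j ∈ S.carrier <;> by_cases hk : k ∈ S.carrier <;>
    simp only [LinearMap.add_apply, Module.End.mul_apply, psiStar_single, hj, hk, hm, if_true,
      if_false, map_zero, true_and, false_and, add_zero, LinearMap.zero_apply]
  have h1 := S.numAbove_clear hj k
  have h2 := S.numAbove_clear hk j
  rcases lt_trichotomy j k with h | rfl | h
  · simp only [h.not_gt, h, if_true, if_false, add_zero] at h1 h2
    simp [h.ne, h.ne', hc, h1, ← h2, ← Finsupp.single_add, -Finsupp.single_mul]
    ring
  · simp
  · simp only [h.not_gt, h, if_true, if_false, add_zero] at h1 h2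
    simp [h.ne, h.ne', hc, ← h1, h2, ← Finsupp.single_add, -Finsupp.single_mul]
    ring

theorem psi_anticomm_psiStar (j k : ℤ) :
    psi K j * psiStar K k + psiStar K k * psi K j = if j = k then 1 else 0 := by
  classical
  refine Finsupp.lhom_ext fun S a => ?_
  have hmf (i l : ℤ) : l ∈ (S.fill i).carrier ↔ l = i ∨ l ∈ S.carrier := Iff.rfl
  have hmc (i l : ℤ) : l ∈ (S.clear i).carrier ↔ l ∈ S.carrier ∧ l ≠ i := Iff.rfl
  rcases eq_or_ne j k with rfl | hne
  · by_cases hj : j ∈ S.carrier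
    · have hc : (S.clear j).fill j = S := by
        ext i; simp only [Maya.fill, Maya.clear]; grind
      have h1 := S.numAbove_clear hj j
      simp only [lt_irrefl, if_false, add_zero] at h1
      simp [psi_single, psiStar_single, hj, hmc, hc, h1, mul_assoc, ← pow_add, ← two_mul,
        -Finsupp.single_mul]
    · have hc : (S.fill j).clear j = S := by
        ext i; simp only [Maya.fill, Maya.clear]; grind
      have h1 := S.numAbove_fill hj j
      simp only [lt_irrefl, if_false, add_zero] at h1
      simp [psi_single, psiStar_single, hj, hmf, hc, h1, mul_assoc, ← pow_add, ← two_mul,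
        -Finsupp.single_mul]
  · by_cases hj : j ∈ S.carrier <;> by_cases hk : k ∈ S.carrier <;>
      simp only [LinearMap.add_apply, Module.End.mul_apply, psi_single, psiStar_single, hj, hk,
        hmf, hmc, hne, hne.symm, if_true, if_false, map_zero, true_and, false_and, or_true,
        or_false, add_zero, LinearMap.zero_apply, ne_eq, not_false_eq_true]
    have hc : (S.clear k).fill j = (S.fill j).clear k := by
      ext i; simp only [Maya.fill, Maya.clear]; grind
    have h1 := S.numAbove_fill hj k
    have h2 := S.numAbove_clear hk j
    rw [hc, h1, ← h2, ← Finsupp.single_add]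
    rcases lt_or_gt_of_ne hne with h | h
    · simp [h, h.not_gt, pow_succ, -Finsupp.single_mul]
      rw [← sub_eq_add_neg, ← Finsupp.single_sub, Finsupp.single_eq_zero]; ring
    · simp [h, h.not_gt, pow_succ, -Finsupp.single_mul]
      rw [← sub_eq_add_neg, ← Finsupp.single_sub, Finsupp.single_eq_zero]; ring

theorem psi_ket_zero {k : ℤ} (hk : k < 0) : psi K k (ket K 0) = 0 := by
  simp [ket, psi_single, Maya.vac, hk]

theorem psiStar_ket_zero {k : ℤ} (hk : 0 ≤ k) : psiStar K k (ket K 0) = 0 := by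
  simp [ket, psiStar_single, Maya.vac, hk]

theorem numAbove_vac {n k : ℤ} (hk : n ≤ k + 1) : (Maya.vac n).numAbove k = 0 := by
  have : {j ∈ (Maya.vac n).carrier | k < j} = ∅ := by
    ext j; simp [Maya.vac]; lia
  rw [Maya.numAbove, this, Set.ncard_empty]

/-- With `psiStar_ket_succ` this gives `|n⟩ = ψ_{n-1} ⋯ ψ_0 |0⟩` for `n > 0` and
`|n⟩ = ψ*_n ⋯ ψ*_{-1} |0⟩` for `n < 0`. -/
theorem psi_ket (n : ℤ) : psi K n (ket K n) = ket K (n + 1) := by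
  have h : (Maya.vac n).fill n = Maya.vac (n + 1) := by
    ext j; simp only [Maya.fill, Maya.vac, Set.mem_insert_iff, Set.mem_Iio]; lia
  simp [ket, psi_single, h, numAbove_vac]
  simp [Maya.vac]

theorem psiStar_ket_succ (n : ℤ) : psiStar K n (ket K (n + 1)) = ket K n := by
  have h : (Maya.vac (n + 1)).clear n = Maya.vac n := by
    ext j; simp [Maya.clear, Maya.vac]; lia
  simp [ket, psiStar_single, h, numAbove_vac]
  simp [Maya.vac]

end Operators

/-! ### The tau function -/

section Tau

variable {K : Type*} [Field K] {σ : Type*}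

/-- The exponential `∑_j f ^ j / j!` of a formal power series `f` with zero constant term, over a
possibly noncommutative `K`-algebra. In a coefficient of total degree `d` the terms with `j > d`
vanish, see `coeff_pow_eq_zero`. -/
def fexp {E : Type*} [Ring E] [Algebra K E] (f : MvPowerSeries σ E) : MvPowerSeries σ E :=
  fun e => ∑ j ∈ Finset.range (e.degree + 1), ((j.factorial : K)⁻¹) • MvPowerSeries.coeff e (f ^ j)

theorem coeff_pow_eq_zero {E : Type*} [Ring E] (f : MvPowerSeries σ E)
    (hf : MvPowerSeries.coeff 0 f = 0) {e : σ →₀ ℕ} {j : ℕ} (hj : e.degree < j) :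
    MvPowerSeries.coeff e (f ^ j) = 0 :=
  MvPowerSeries.coeff_of_lt_order (lt_of_lt_of_le (by exact_mod_cast hj)
    (MvPowerSeries.le_order_pow_of_constantCoeff_eq_zero j hf))

/-- The formal power series `∑_{m ≥ 1} t_m O_m`, with operator coefficients, for times `t_m` that
are formal power series such that every monomial occurs in only finitely many `t_m`. -/
def opSeries (O : ℕ+ → Module.End K (Fock K)) (t : ℕ+ → MvPowerSeries σ K) :
    MvPowerSeries σ (Module.End K (Fock K)) :=
  fun e => ∑ᶠ m : ℕ+, MvPowerSeries.coeff e (t m) • O m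

/-- The hypergeometric tau function `τ_r(n, t, t*) = ⟨n| e^{H(t)} e^{-A(t*)} |n⟩`, where
`H(t) = ∑ t_m H_m` and `A(t*) = ∑ t*_m A_m`, as a formal power series. -/
def tau (r : ℤ → K) (n : ℤ) (t ts : ℕ+ → MvPowerSeries σ K) : MvPowerSeries σ K :=
  fun e => bra K n (MvPowerSeries.coeff e
    (fexp (K := K) (opSeries (opH K) t) * fexp (K := K) (-opSeries (opA r) ts)) (ket K n))

/-- The times `t^{[p]}`: `t^{[p]}_{pk} = t_k`, and `t^{[p]}_m = 0` when `p` does not divide `m`. -/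
def timesPow {A : Type*} [Zero A] (p : ℕ+) (t : ℕ+ → A) : ℕ+ → A :=
  fun m => if (p : ℕ) ∣ (m : ℕ) then t (PNat.divExact m p) else 0

variable (K) in
/-- The times `t_1, t_2, …` as independent indeterminates. -/
def timeT (m : ℕ+) : MvPowerSeries (ℕ+ ⊕ ℕ+) K := MvPowerSeries.X (Sum.inl m)

variable (K) in
/-- The times `t*_1, t*_2, …` as a second family of independent indeterminates. -/
def timeTs (m : ℕ+) : MvPowerSeries (ℕ+ ⊕ ℕ+) K := MvPowerSeries.X (Sum.inr m)

/-- `R(k) = r(k) r(k-1) ⋯ r(k-p+1)`. -/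
def bigR (r : ℤ → K) (p : ℕ+) (k : ℤ) : K := ∏ j ∈ Finset.range (p : ℕ), r (k - j)

/-- `r^{(m)}(k) = R(kp + m - 1)`. -/
def colorR (r : ℤ → K) (p : ℕ+) (m : ℕ) (k : ℤ) : K := bigR r p (k * (p : ℕ) + m - 1)

end Tau

end HypTau

end

-- Only `H_{pm}` and `A_{pm}` survive in the times `t^{[p]}`, and they move a fermion by a multiple
-- of `p`. The modes therefore split into `p` residue classes (colours), and each of these operators
-- is a sum of bilinears in one colour (`opH_mul`, `neg_opA_mul`). Bilinears of different colours
-- commute, so the exponentials split into products (`fexp_add`), regrouped colour by colour.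
--
-- The vacuum expectation value of such a product is the product of the expectation values
-- (`bra_mul`): an intermediate wedge other than the vacuum differs from it in some mode, and one of
-- the two operators preserves the occupation of that mode. The two sides are expressed by
-- commutants, `modeAlgebra` and `coModeAlgebra`, because the bilinears are infinite sums of
-- products of fermions and need not lie in the algebra that these products generate.
--
-- Finally, the modes of one colour form a copy of `ℤ`. Relabelling `k` as `kp + c - 1` embeds the
-- Fock space into itself and intertwines the fermions, up to signs absorbed in `fockEmbed`.
-- Products of `pm` consecutive values of `r` become products of `m` values of `r^{(c)}`
-- (`weight_mul_colorMode`), and the vacuum of charge `np + i` restricts to charge `n + 1` for `c ≤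
-- i` and to `n` otherwise (`colorMode_lt_iff`).

noncomputable section

namespace HypTau

-- Exponentials of power series with noncommuting coefficients

section PowerSeries

open MvPowerSeries

variable {K : Type*} [Field K] {σ E : Type*} [Ring E] [Algebra K E]

theorem coeff_fexp_eq_sum (f : MvPowerSeries σ E) (e : σ →₀ ℕ) :
    coeff e (fexp (K := K) f) =
      ∑ j ∈ Finset.range (e.degree + 1), ((j.factorial : K)⁻¹) • coeff e (f ^ j) := rfl

/-- Any larger truncation gives the same coefficient, so several exponentials can share one bound.
-/
theorem coeff_fexp {f : MvPowerSeries σ E} (hf : coeff 0 f = 0) (e : σ →₀ ℕ) {N : ℕ}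
    (hN : e.degree < N) :
    coeff e (fexp (K := K) f) =
      ∑ j ∈ Finset.range N, ((j.factorial : K)⁻¹) • coeff e (f ^ j) := by
  refine Finset.sum_subset (Finset.range_mono hN) fun j _ hj => ?_
  rw [coeff_pow_eq_zero f hf (by simpa using hj), smul_zero]

theorem fexp_zero : fexp (K := K) (0 : MvPowerSeries σ E) = 1 := by
  ext e
  rw [coeff_fexp (map_zero _) e (Nat.lt_succ_self _), Finset.sum_range_succ']
  simp

theorem coeff_pow_mul_pow_eq_zero {f g : MvPowerSeries σ E} (hf : coeff 0 f = 0)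
    (hg : coeff 0 g = 0) {e : σ →₀ ℕ} {a b : ℕ} (h : e.degree < a + b) :
    coeff e (f ^ a * g ^ b) = 0 := by
  classical
  rw [coeff_mul]
  refine Finset.sum_eq_zero fun x hx => ?_
  rw [Finset.HasAntidiagonal.mem_antidiagonal] at hx
  have hd : x.1.degree + x.2.degree = e.degree := by rw [← hx, map_add]
  rcases lt_or_ge x.1.degree a with h1 | h1
  · rw [coeff_pow_eq_zero f hf h1, zero_mul]
  · rw [coeff_pow_eq_zero g hg (by lia), mul_zero]

/-- The exponential of a sum of commuting series is the product of the exponentials. -/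
theorem fexp_add [CharZero K] {f g : MvPowerSeries σ E} (hf : coeff 0 f = 0)
    (hg : coeff 0 g = 0) (h : Commute f g) :
    fexp (K := K) (f + g) = fexp (K := K) f * fexp (K := K) g := by
  classical
  ext e
  set N := e.degree + 1 with hN
  have hterm (j : ℕ) : ((j.factorial : K)⁻¹) • coeff e ((f + g) ^ j) =
      ∑ x ∈ Finset.HasAntidiagonal.antidiagonal j,
        ((x.1.factorial : K)⁻¹ * (x.2.factorial : K)⁻¹) • coeff e (f ^ x.1 * g ^ x.2) := by
    rw [h.add_pow', map_sum, Finset.smul_sum]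
    refine Finset.sum_congr rfl fun x hx => ?_
    rw [Finset.HasAntidiagonal.mem_antidiagonal] at hx
    rw [map_nsmul, ← Nat.cast_smul_eq_nsmul K, smul_smul]
    congr 1
    have h1 := Nat.choose_mul_factorial_mul_factorial (n := j) (k := x.1) (by lia)
    rw [show j - x.1 = x.2 by lia] at h1
    have h2 : (j.choose x.1 : K) * x.1.factorial * x.2.factorial = j.factorial := by
      exact_mod_cast h1
    -- The only place where characteristic zero enters.
    have h3 : (x.1.factorial : K) ≠ 0 := by exact_mod_cast x.1.factorial_ne_zero
    have h4 : (x.2.factorial : K) ≠ 0 := by exact_mod_cast x.2.factorial_ne_zero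
    have h5 : (j.factorial : K) ≠ 0 := by exact_mod_cast j.factorial_ne_zero
    field_simp
    rw [← h2]
  -- With the common bound `N` the product is a sum over a square of exponents. The left side is the
  -- sum over the triangle `x.1 + x.2 < N`; outside it the terms vanish for reasons of degree.
  have hR : coeff e (fexp (K := K) f * fexp (K := K) g) =
      ∑ x ∈ Finset.range N ×ˢ Finset.range N,
        ((x.1.factorial : K)⁻¹ * (x.2.factorial : K)⁻¹) • coeff e (f ^ x.1 * g ^ x.2) := by
    simp_rw [coeff_mul, Finset.smul_sum]
    rw [Finset.sum_comm]
    refine Finset.sum_congr rfl fun x hx => ?_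
    rw [Finset.HasAntidiagonal.mem_antidiagonal] at hx
    have hd : x.1.degree + x.2.degree = e.degree := by rw [← hx, map_add]
    rw [coeff_fexp hf x.1 (N := N) (by lia), coeff_fexp hg x.2 (N := N) (by lia),
      Finset.sum_mul_sum, Finset.sum_product]
    simp_rw [smul_mul_smul_comm]
  rw [coeff_fexp (by rw [map_add, hf, hg, add_zero]) e (Nat.lt_succ_self _), hR,
    Finset.sum_congr rfl fun j _ => hterm j]
  have hfib := Finset.sum_fiberwise_of_maps_to
    (s := (Finset.range N ×ˢ Finset.range N).filter fun x => x.1 + x.2 < N)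
    (t := Finset.range N) (g := fun x => x.1 + x.2)
    (fun x hx => by simpa using (Finset.mem_filter.1 hx).2)
    fun x => ((x.1.factorial : K)⁻¹ * (x.2.factorial : K)⁻¹) • coeff e (f ^ x.1 * g ^ x.2)
  calc _ = _ := Finset.sum_congr rfl fun j hj => Finset.sum_congr (by
          ext x
          simp only [Finset.HasAntidiagonal.mem_antidiagonal, Finset.mem_filter, Finset.mem_product,
            Finset.mem_range] at hj ⊢
          lia) fun _ _ => rfl
    _ = _ := hfib
    _ = _ := Finset.sum_subset (Finset.filter_subset _ _) fun x _ hx => by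
          rw [coeff_pow_mul_pow_eq_zero hf hg, smul_zero]
          simp only [Finset.mem_filter, not_and] at hx
          have := hx ‹_›
          lia

/-- All coefficients of the series lie in a given subalgebra. -/
def CoeffsIn (A : Subalgebra K E) (f : MvPowerSeries σ E) : Prop := ∀ e, coeff e f ∈ A

variable {A : Subalgebra K E} {f g : MvPowerSeries σ E}

theorem CoeffsIn.mul (hf : CoeffsIn A f) (hg : CoeffsIn A g) : CoeffsIn A (f * g) := by
  classical
  intro e
  rw [coeff_mul]
  exact sum_mem fun x _ => mul_mem (hf _) (hg _)

theorem CoeffsIn.pow (hf : CoeffsIn A f) (j : ℕ) : CoeffsIn A (f ^ j) := by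
  classical
  induction j with
  | zero =>
    intro e
    rw [pow_zero, coeff_one]
    split_ifs
    exacts [one_mem A, zero_mem A]
  | succ j ih => rw [pow_succ]; exact ih.mul hf

theorem CoeffsIn.sum {ι : Type*} {s : Finset ι} {f : ι → MvPowerSeries σ E}
    (hf : ∀ i ∈ s, CoeffsIn A (f i)) : CoeffsIn A (∑ i ∈ s, f i) := by
  intro e
  rw [map_sum]
  exact sum_mem fun i hi => hf i hi e

theorem CoeffsIn.fexp (hf : CoeffsIn A f) : CoeffsIn A (fexp (K := K) f) :=
  fun e => by
    rw [coeff_fexp_eq_sum]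
    exact sum_mem fun j _ => A.smul_mem (hf.pow j e) _

theorem CoeffsIn.commute (hf : CoeffsIn A f)
    (hg : CoeffsIn (Subalgebra.centralizer K (A : Set E)) g) : Commute f g := by
  classical
  ext e
  rw [coeff_mul, coeff_mul]
  refine Finset.sum_nbij' Prod.swap Prod.swap ?_ ?_ (fun _ _ => rfl) (fun _ _ => rfl)
    fun x _ => Subalgebra.mem_centralizer_iff K |>.1 (hg _) _ (hf _)
  all_goals
    intro x hx
    rw [Finset.HasAntidiagonal.mem_antidiagonal] at hx ⊢
    rw [← hx, Prod.fst_swap, Prod.snd_swap, add_comm]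

/-- The series has no constant term. -/
def NoConstTerm (f : MvPowerSeries σ E) : Prop := coeff 0 f = 0

theorem NoConstTerm.sum {ι : Type*} {s : Finset ι} {f : ι → MvPowerSeries σ E}
    (hf : ∀ i ∈ s, NoConstTerm (f i)) : NoConstTerm (∑ i ∈ s, f i) := by
  rw [NoConstTerm, map_sum]
  exact Finset.sum_eq_zero hf

/-- `f` and `g` need not commute, nor `f'` and `g'`: regrouping only moves the exponential of `f'`
past that of `g`. -/
theorem fexp_add_mul_fexp_add [CharZero K] {f' g' : MvPowerSeries σ E} (hf0 : NoConstTerm f)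
    (hg0 : NoConstTerm g) (hf0' : NoConstTerm f') (hg0' : NoConstTerm g') (hf : CoeffsIn A f)
    (hg : CoeffsIn A g) (hf' : CoeffsIn (Subalgebra.centralizer K (A : Set E)) f')
    (hg' : CoeffsIn (Subalgebra.centralizer K (A : Set E)) g') :
    fexp (K := K) (f + f') * fexp (K := K) (g + g') =
      (fexp (K := K) f * fexp (K := K) g) * (fexp (K := K) f' * fexp (K := K) g') := by
  rw [fexp_add hf0 hf0' (hf.commute hf'), fexp_add hg0 hg0' (hg.commute hg'),
    (hg.fexp.commute hf'.fexp).symm.mul_mul_mul_comm]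

end PowerSeries

-- Transport of operator series along a linear map

section Intertwining

open MvPowerSeries

variable {K : Type*} [Field K] {σ V W : Type*} [AddCommGroup V] [Module K V] [AddCommGroup W]
  [Module K W]

/-- The coefficients of two series of operators are intertwined by a linear map. -/
def Intertwines (Φ : V →ₗ[K] W) (f : MvPowerSeries σ (Module.End K V))
    (g : MvPowerSeries σ (Module.End K W)) : Prop :=
  ∀ e v, coeff e g (Φ v) = Φ (coeff e f v)

variable {Φ : V →ₗ[K] W} {f f' : MvPowerSeries σ (Module.End K V)}
  {g g' : MvPowerSeries σ (Module.End K W)}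

theorem Intertwines.mul (h : Intertwines Φ f g) (h' : Intertwines Φ f' g') :
    Intertwines Φ (f * f') (g * g') := by
  classical
  intro e v
  simp_rw [coeff_mul, LinearMap.sum_apply, map_sum, Module.End.mul_apply]
  exact Finset.sum_congr rfl fun x _ => by rw [h' x.2 v, h x.1]

theorem Intertwines.pow (h : Intertwines Φ f g) (j : ℕ) : Intertwines Φ (f ^ j) (g ^ j) := by
  classical
  induction j with
  | zero =>
    intro e v
    simp_rw [pow_zero, coeff_one]
    split_ifs <;> simp
  | succ j ih => simp_rw [pow_succ]; exact ih.mul h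

theorem Intertwines.fexp (h : Intertwines Φ f g) :
    Intertwines Φ (fexp (K := K) f) (fexp (K := K) g) := by
  intro e v
  simp_rw [coeff_fexp_eq_sum, LinearMap.sum_apply, map_sum, LinearMap.smul_apply, map_smul,
    h.pow _ e v]

end Intertwining

-- Infinite bilinears in the fermions

section Bilinear

variable {K : Type*} [Field K]

theorem finite_support_bilinear_apply (c : ℤ → K) {m : ℤ} (hm : m ≠ 0) (v : Fock K) :
    {k : ℤ | c k • psi K k (psiStar K (k + m) v) ≠ 0}.Finite := by
  induction v using Finsupp.induction_linear with
  | zero => simp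
  | add f g hf hg =>
    refine (hf.union hg).subset fun k hk => ?_
    by_contra h
    simp only [Set.mem_union, Set.mem_ofPred_eq, not_or, not_not] at h
    exact hk (by rw [map_add, map_add, smul_add, h.1, h.2, add_zero])
  | single S a =>
    refine (finite_support_bilinear c hm S).subset fun k hk h => hk ?_
    rw [← mul_one a, ← smul_eq_mul, ← Finsupp.smul_single, map_smul, map_smul, smul_comm, h,
      smul_zero]

theorem bilinear_apply (c : ℤ → K) {m : ℤ} (hm : m ≠ 0) (v : Fock K) :
    bilinear c m v = ∑ᶠ k : ℤ, c k • psi K k (psiStar K (k + m) v) := by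
  induction v using Finsupp.induction_linear with
  | zero => simp
  | add f g hf hg =>
    rw [map_add, hf, hg, ← finsum_add_distrib (finite_support_bilinear_apply c hm f)
      (finite_support_bilinear_apply c hm g)]
    simp_rw [map_add, smul_add]
  | single S a =>
    rw [bilinear, Finsupp.linearCombination_single, smul_finsum' _ (finite_support_bilinear c hm S)]
    refine finsum_congr fun k => ?_
    rw [smul_comm, ← map_smul (psi K k), ← map_smul (psiStar K (k + m)), Finsupp.smul_single,
      smul_eq_mul, mul_one]

/-- An operator that commutes with every term of the bilinear sum commutes with the sum. -/
theorem commute_bilinear {c : ℤ → K} {m : ℤ} (hm : m ≠ 0) {X : Module.End K (Fock K)}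
    (h : ∀ k, c k ≠ 0 → Commute X (psi K k * psiStar K (k + m))) :
    Commute X (bilinear c m) := by
  refine LinearMap.ext fun v => ?_
  rw [Module.End.mul_apply, Module.End.mul_apply, bilinear_apply c hm, bilinear_apply c hm]
  refine (X.toAddMonoidHom.map_finsum (finite_support_bilinear_apply c hm v)).trans
    (finsum_congr fun k => ?_)
  rcases eq_or_ne (c k) 0 with hk | hk
  · simp [hk]
  · exact (map_smul X _ _).trans (congrArg (c k • ·) (LinearMap.congr_fun (h k hk) v))

theorem bilinear_sum {ι : Type*} (s : Finset ι) (c : ι → ℤ → K) {m : ℤ} (hm : m ≠ 0) :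
    bilinear (∑ i ∈ s, c i) m = ∑ i ∈ s, bilinear (c i) m := by
  refine LinearMap.ext fun v => ?_
  rw [bilinear_apply _ hm, LinearMap.sum_apply]
  simp_rw [bilinear_apply _ hm, Finset.sum_apply, Finset.sum_smul]
  exact finsum_sum_comm _ _ fun i _ => finite_support_bilinear_apply (c i) hm v

/-- Moving `a * b` past `c * d` takes four transpositions, each with a sign `-1`. -/
theorem commute_mul_mul_of_anticomm {R : Type*} [Ring R] {a b c d : R} (hac : a * c + c * a = 0)
    (hbd : b * d + d * b = 0) (had : a * d + d * a = 0) (hcb : c * b + b * c = 0) :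
    Commute (a * b) (c * d) := by
  have h1 := eq_neg_of_add_eq_zero_left hac
  have h2 := eq_neg_of_add_eq_zero_left hbd
  have h3 := eq_neg_of_add_eq_zero_left had
  have h4 := eq_neg_of_add_eq_zero_right hcb
  calc a * b * (c * d) = a * (b * c) * d := by simp only [mul_assoc]
    _ = -(a * c * (b * d)) := by rw [h4]; simp only [mul_assoc, mul_neg, neg_mul]
    _ = -(c * (a * d) * b) := by rw [h1, h2]; simp only [mul_assoc, mul_neg, neg_mul, neg_neg]
    _ = c * d * (a * b) := by rw [h3]; simp only [mul_assoc, mul_neg, neg_mul, neg_neg]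

theorem psi_mul_psiStar_commute {i j k l : ℤ} (hil : i ≠ l) (hjk : k ≠ j) :
    Commute (psi K i * psiStar K j) (psi K k * psiStar K l) :=
  commute_mul_mul_of_anticomm (R := Module.End K (Fock K)) (psi_anticomm_psi i k) (psiStar_anticomm_psiStar j l)
    ((psi_anticomm_psiStar i l).trans (if_neg hil)) ((psi_anticomm_psiStar k j).trans (if_neg hjk))

open Classical in
-- This is the occupation number operator of the mode `k`; the two fermionic signs coincide and
-- cancel.
theorem psi_mul_psiStar_self_single (k : ℤ) (S : Maya) (a : K) :
    (psi K k * psiStar K k) (Finsupp.single S a) =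
      if k ∈ S.carrier then Finsupp.single S a else 0 := by
  rw [Module.End.mul_apply, psiStar_single]
  split_ifs with h
  · have hc : (S.clear k).fill k = S := by ext i; simp only [Maya.fill, Maya.clear]; grind
    have h1 := S.numAbove_clear h k
    simp only [lt_irrefl, if_false, add_zero] at h1
    rw [psi_single, if_neg (by simp [Maya.clear]), hc, h1, mul_assoc, ← pow_add, ← two_mul,
      pow_mul]
    simp
  · simp

end Bilinear

-- Factorization of vacuum expectation values

section Factorization

open MvPowerSeries

variable (K : Type*) [Field K]

/-- The operators that commute with all bilinears in the fermions with modes outside `D`. -/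
def modeAlgebra (D : Set ℤ) : Subalgebra K (Module.End K (Fock K)) :=
  Subalgebra.centralizer K {X | ∃ k ∉ D, ∃ l ∉ D, X = psi K k * psiStar K l}

/-- The operators that commute with all of `modeAlgebra K D`. -/
def coModeAlgebra (D : Set ℤ) : Subalgebra K (Module.End K (Fock K)) :=
  Subalgebra.centralizer K (modeAlgebra K D : Set (Module.End K (Fock K)))

variable {K} {D : Set ℤ}

theorem psi_mul_psiStar_mem_modeAlgebra {k l : ℤ} (hk : k ∈ D) (hl : l ∈ D) :
    psi K k * psiStar K l ∈ modeAlgebra K D := by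
  rw [modeAlgebra, Subalgebra.mem_centralizer_iff]
  rintro _ ⟨i, hi, j, hj, rfl⟩
  exact psi_mul_psiStar_commute (by rintro rfl; exact hi hl) (by rintro rfl; exact hj hk)

/-- A generating set lies in its double commutant. -/
theorem psi_mul_psiStar_mem_coModeAlgebra {k l : ℤ} (hk : k ∉ D) (hl : l ∉ D) :
    psi K k * psiStar K l ∈ coModeAlgebra K D := by
  rw [coModeAlgebra, Subalgebra.mem_centralizer_iff]
  intro X hX
  exact ((Subalgebra.mem_centralizer_iff K).1 hX _ ⟨k, hk, l, hl, rfl⟩).symm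

theorem bilinear_mem_modeAlgebra {c : ℤ → K} {m : ℤ} (hm : m ≠ 0)
    (h : ∀ k, c k ≠ 0 → k ∈ D ∧ k + m ∈ D) : bilinear c m ∈ modeAlgebra K D := by
  rw [modeAlgebra, Subalgebra.mem_centralizer_iff]
  intro X hX
  refine commute_bilinear hm fun k hk => ?_
  exact (Subalgebra.mem_centralizer_iff K).1
    (psi_mul_psiStar_mem_modeAlgebra (h k hk).1 (h k hk).2) X hX

theorem bilinear_mem_coModeAlgebra {c : ℤ → K} {m : ℤ} (hm : m ≠ 0)
    (h : ∀ k, c k ≠ 0 → k ∉ D ∧ k + m ∉ D) : bilinear c m ∈ coModeAlgebra K D := by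
  rw [coModeAlgebra, Subalgebra.mem_centralizer_iff]
  intro X hX
  refine commute_bilinear hm fun k hk => ?_
  exact (Subalgebra.mem_centralizer_iff K).1
    (psi_mul_psiStar_mem_coModeAlgebra (h k hk).1 (h k hk).2) X hX

/-- Matrix elements of an operator that preserves the occupation number of the mode `k` vanish
between diagrams that differ in the mode `k`. -/
theorem apply_single_eq_zero_of_commute {X : Module.End K (Fock K)} {k : ℤ}
    (hX : Commute (psi K k * psiStar K k) X) {S T : Maya}
    (h : ¬(k ∈ S.carrier ↔ k ∈ T.carrier)) : X (Finsupp.single S 1) T = 0 := by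
  classical
  -- The occupation number operator is diagonal in the wedge basis. Reading the commutation relation
  -- at `T` on the image of `S` then forces the matrix element to vanish.
  have hdiag (v : Fock K) : (psi K k * psiStar K k) v T = if k ∈ T.carrier then v T else 0 := by
    induction v using Finsupp.induction_linear with
    | zero => simp
    | add f g hf hg => rw [map_add, Finsupp.add_apply, hf, hg]; split_ifs <;> simp
    | single S a =>
      rw [psi_mul_psiStar_self_single]
      rcases eq_or_ne S T with rfl | hST
      · split_ifs <;> simp
      · split_ifs <;> simp [hST]
  have h1 := hdiag (X (Finsupp.single S 1))
  rw [← Module.End.mul_apply, hX.eq, Module.End.mul_apply, psi_mul_psiStar_self_single] at h1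
  by_cases hS : k ∈ S.carrier <;> by_cases hT : k ∈ T.carrier <;> simp_all

/-- Vacuum expectation values factorize over disjoint sets of modes. -/
theorem bra_mul {X Y : Module.End K (Fock K)} (hX : X ∈ modeAlgebra K D)
    (hY : Y ∈ coModeAlgebra K D) (N : ℤ) :
    bra K N ((X * Y) (ket K N)) = bra K N (X (ket K N)) * bra K N (Y (ket K N)) := by
  -- In a mode `k` where `S` differs from the vacuum: if `k ∈ D`, then `Y` preserves its occupation
  -- and cannot reach `S`; if `k ∉ D`, then `X` preserves it and cannot return from `S`. Only the
  -- vacuum survives as an intermediate state.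
  have key (S : Maya) (hS : S ≠ Maya.vac N) :
      X (Finsupp.single S 1) (Maya.vac N) * Y (ket K N) S = 0 := by
    obtain ⟨k, hk⟩ : ∃ k, ¬(k ∈ S.carrier ↔ k ∈ (Maya.vac N).carrier) := by
      by_contra! h
      exact hS (Maya.ext (Set.ext h))
    by_cases hkD : k ∈ D
    · rw [ket, apply_single_eq_zero_of_commute (k := k) _ fun h => hk h.symm, mul_zero]
      exact (Subalgebra.mem_centralizer_iff K).1 hY _ (psi_mul_psiStar_mem_modeAlgebra hkD hkD)
    · rw [apply_single_eq_zero_of_commute (k := k) _ hk, zero_mul]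
      exact (Subalgebra.mem_centralizer_iff K).1 hX _ ⟨k, hkD, k, hkD, rfl⟩
  have hexp (v : Fock K) : bra K N (X v) =
      v.sum fun S a => a * X (Finsupp.single S 1) (Maya.vac N) := by
    conv_lhs => rw [← Finsupp.sum_single v]
    rw [Finsupp.sum, Finsupp.sum, map_sum, map_sum]
    refine Finset.sum_congr rfl fun S _ => ?_
    rw [← mul_one (v S), ← smul_eq_mul, ← Finsupp.smul_single, map_smul, map_smul]
    simp [bra]
  rw [Module.End.mul_apply, hexp (Y (ket K N)), Finsupp.sum,
    Finset.sum_eq_single (Maya.vac N)]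
  · rw [mul_comm]; rfl
  · intro S _ hS
    rw [mul_comm, key S hS]
  · intro h
    rw [Finsupp.notMem_support_iff.1 h, zero_mul]

variable (K) in
/-- The vacuum expectation value of a series of operators. -/
def vev {σ : Type*} (N : ℤ) (f : MvPowerSeries σ (Module.End K (Fock K))) : MvPowerSeries σ K :=
  fun e => bra K N (coeff e f (ket K N))

variable {σ : Type*} {f g : MvPowerSeries σ (Module.End K (Fock K))}

theorem coeff_vev (N : ℤ) (e : σ →₀ ℕ) :
    coeff e (vev K N f) = bra K N (coeff e f (ket K N)) := rfl

theorem vev_one (N : ℤ) : vev K N (1 : MvPowerSeries σ (Module.End K (Fock K))) = 1 := by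
  classical
  ext e
  rw [coeff_vev, coeff_one, coeff_one]
  split_ifs <;> simp [bra, ket]

theorem vev_mul (hf : CoeffsIn (modeAlgebra K D) f) (hg : CoeffsIn (coModeAlgebra K D) g)
    (N : ℤ) : vev K N (f * g) = vev K N f * vev K N g := by
  classical
  ext e
  rw [coeff_vev, coeff_mul, coeff_mul, LinearMap.sum_apply, map_sum]
  exact Finset.sum_congr rfl fun x _ => bra_mul (hf _) (hg _) N

end Factorization

/-- Reindexes both the sums over modes of one colour and the sums over times with index divisible by
`p`. -/
theorem finsum_eq_finsum_comp {α β M : Type*} [AddCommMonoid M] {f : α → M} {g : β → α}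
    (hg : Function.Injective g) (h : Function.support f ⊆ Set.range g) :
    ∑ᶠ i, f i = ∑ᶠ j, f (g j) := by
  rw [← finsum_mem_range hg, ← finsum_mem_univ]
  exact finsum_mem_inter_support_eq' _ _ _ fun x hx => iff_of_true trivial (h hx)

-- Embedding the Fock space along a relabelling of the modes

section Embedding

namespace Maya

/-- The diagram whose modes in the range of `ι` are those of `T` and whose other modes are those
of `M`. -/
def embed {ι : ℤ → ℤ} (hι : StrictMono ι) (M T : Maya) : Maya where
  carrier := ι '' T.carrier ∪ (M.carrier \ Set.range ι)
  below := by
    obtain ⟨a, ha⟩ := T.below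
    obtain ⟨b, hb⟩ := M.below
    refine ⟨min (ι a) b, fun x hx => ?_⟩
    by_cases h : x ∈ Set.range ι
    · obtain ⟨k, rfl⟩ := h
      exact Or.inl ⟨k, ha k (hι.lt_iff_lt.1 (by lia)), rfl⟩
    · exact Or.inr ⟨hb x (by lia), h⟩
  above := by
    obtain ⟨a, ha⟩ := T.above
    obtain ⟨b, hb⟩ := M.above
    refine ⟨max (ι a) b, ?_⟩
    rintro _ (⟨k, hk, rfl⟩ | ⟨hx, -⟩)
    · exact lt_max_of_lt_left (hι (ha k hk))
    · exact lt_max_of_lt_right (hb _ hx)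

variable {ι : ℤ → ℤ} (hι : StrictMono ι) (M T : Maya)

theorem apply_mem_embed (k : ℤ) : ι k ∈ (embed hι M T).carrier ↔ k ∈ T.carrier := by
  simp [embed, hι.injective.eq_iff]

theorem embed_fill (k : ℤ) : embed hι M (T.fill k) = (embed hι M T).fill (ι k) := by
  ext x
  simp only [embed, fill, Set.image_insert_eq, Set.insert_union]

theorem embed_clear (k : ℤ) : embed hι M (T.clear k) = (embed hι M T).clear (ι k) := by
  ext x
  simp only [embed, clear, Set.image_sdiff hι.injective, Set.image_singleton, Set.union_sdiff_distrib]
  simp only [Set.mem_union, Set.mem_sdiff, Set.mem_range, Set.mem_singleton_iff]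
  constructor
  · rintro (h | h)
    · exact Or.inl h
    · exact Or.inr ⟨h, fun hx => h.2 ⟨k, hx.symm⟩⟩
  · rintro (h | h)
    · exact Or.inl h
    · exact Or.inr h.1

/-- The second summand does not depend on `T`, so the discrepancy between the fermionic signs is a
fixed function of `k`, namely `outerSign`. -/
theorem numAbove_embed (k : ℤ) : (embed hι M T).numAbove (ι k) =
    T.numAbove k + {j ∈ M.carrier \ Set.range ι | ι k < j}.ncard := by
  have h : {j ∈ (embed hι M T).carrier | ι k < j} =
      ι '' {j ∈ T.carrier | k < j} ∪ {j ∈ M.carrier \ Set.range ι | ι k < j} := by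
    ext x
    constructor
    · rintro ⟨⟨j, hj, rfl⟩ | hx, hlt⟩
      · exact Or.inl ⟨j, ⟨hj, hι.lt_iff_lt.1 hlt⟩, rfl⟩
      · exact Or.inr ⟨hx, hlt⟩
    · rintro (⟨j, ⟨hj, hlt⟩, rfl⟩ | ⟨hx, hlt⟩)
      · exact ⟨Or.inl ⟨j, hj, rfl⟩, hι hlt⟩
      · exact ⟨Or.inr hx, hlt⟩
  rw [numAbove, h, Set.ncard_union_eq _ ((T.finite_above k).image ι)
    ((M.finite_above (ι k)).subset fun x hx => ⟨hx.1.1, hx.2⟩),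
    Set.ncard_image_of_injective _ hι.injective, numAbove]
  rw [Set.disjoint_left]
  rintro _ ⟨j, -, rfl⟩ ⟨⟨-, h⟩, -⟩
  exact h ⟨j, rfl⟩

theorem embed_vac_iff {N n : ℤ} (h : ∀ k, ι k < N ↔ k < n) :
    embed hι (vac N) T = vac N ↔ T = vac n := by
  constructor
  · intro hT
    ext k
    rw [← apply_mem_embed hι (vac N) T k, hT]
    exact h k
  · rintro rfl
    ext x
    by_cases hx : x ∈ Set.range ι
    · obtain ⟨k, rfl⟩ := hx
      rw [apply_mem_embed]
      exact (h k).symm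
    · simp only [embed, Set.mem_union, Set.mem_sdiff, hx, not_false_eq_true, and_true]
      refine or_iff_right ?_
      rintro ⟨k, -, rfl⟩
      exact hx ⟨k, rfl⟩

open Classical in
/-- The contribution of the mode `j` to `relSign`. -/
def modeSign (s : ℤ → ℤˣ) (T : Maya) (j : ℤ) : ℤˣ := if j ∈ T.carrier ↔ j < 0 then 1 else s j

/-- The product of the signs of the modes in which `T` differs from the vacuum. -/
def relSign (s : ℤ → ℤˣ) (T : Maya) : ℤˣ := ∏ᶠ j, T.modeSign s j

/-- Far down all modes are occupied and far up none is, as in the vacuum of charge `0`, the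
reference in `modeSign`. -/
theorem finite_mulSupport_modeSign (s : ℤ → ℤˣ) : (T.modeSign s).mulSupport.Finite := by
  obtain ⟨a, ha⟩ := T.below
  obtain ⟨b, hb⟩ := T.above
  refine (Set.finite_Icc (min a 0) (max b 0)).subset fun j hj => ?_
  by_contra h
  refine hj (if_pos ?_)
  rw [Set.mem_Icc, not_and_or] at h
  rcases h with h | h
  · exact iff_of_true (ha j (by lia)) (by lia)
  · exact iff_of_false (fun h' => by have := hb j h'; lia) (by lia)

/-- Toggling the mode `k` either introduces or removes the factor `s k`. Since `s k` is its own
inverse, the same rule serves filling and clearing. -/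
theorem relSign_eq_mul_of_eq {s : ℤ → ℤˣ} {S T : Maya} {k : ℤ}
    (h : ∀ j ≠ k, j ∈ S.carrier ↔ j ∈ T.carrier) (hk : ¬(k ∈ S.carrier ↔ k ∈ T.carrier)) :
    relSign s S = relSign s T * s k := by
  classical
  have hfin : (fun j => if j = k then s k else 1).mulSupport.Finite :=
    (Set.finite_singleton k).subset fun j hj => by
      by_contra hne
      exact hj (if_neg hne)
  have h1 : s k = ∏ᶠ j, if j = k then s k else 1 := by
    rw [finprod_eq_single _ k fun j hj => if_neg hj, if_pos rfl]
  conv_rhs => rw [h1]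
  rw [relSign, relSign, ← finprod_mul_distrib (T.finite_mulSupport_modeSign s) hfin]
  refine finprod_congr fun j => ?_
  rcases eq_or_ne j k with rfl | hj
  · unfold modeSign
    by_cases h2 : j ∈ S.carrier ↔ j < 0
    · rw [if_pos h2, if_neg fun h3 => hk (h2.trans h3.symm), if_pos rfl, Int.units_mul_self]
    · rw [if_neg h2, if_pos (by tauto), if_pos rfl, one_mul]
  · rw [if_neg hj, mul_one, modeSign, modeSign, h j hj]

theorem relSign_fill (s : ℤ → ℤˣ) {k : ℤ} (hk : k ∉ T.carrier) :
    relSign s (T.fill k) = relSign s T * s k :=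
  relSign_eq_mul_of_eq (fun j hj => by simp [fill, hj]) (by simp [fill, hk])

theorem relSign_clear (s : ℤ → ℤˣ) {k : ℤ} (hk : k ∈ T.carrier) :
    relSign s (T.clear k) = relSign s T * s k :=
  relSign_eq_mul_of_eq (fun j hj => by simp [clear, hj]) (by simp [clear, hk])

end Maya

variable (K : Type*) [Field K] {ι : ℤ → ℤ} (hι : StrictMono ι) (M : Maya)

/-- The sign of moving the mode `ι k` to the front of the modes of `M` outside the range of
`ι`. -/
def outerSign (ι : ℤ → ℤ) (M : Maya) (k : ℤ) : ℤˣ :=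
  (-1) ^ {j ∈ M.carrier \ Set.range ι | ι k < j}.ncard

/-- The map of Fock spaces that relabels the modes by `ι` and fills the other modes as in `M`. -/
def fockEmbed : Fock K →ₗ[K] Fock K :=
  Finsupp.linearCombination K fun T : Maya =>
    Finsupp.single (Maya.embed hι M T) (((T.relSign (outerSign ι M) : ℤˣ) : ℤ) : K)

variable {K}

theorem fockEmbed_single (T : Maya) (a : K) :
    fockEmbed K hι M (Finsupp.single T a) =
      Finsupp.single (Maya.embed hι M T) (a * ((T.relSign (outerSign ι M) : ℤˣ) : ℤ)) := by
  rw [fockEmbed, Finsupp.linearCombination_single, Finsupp.smul_single, smul_eq_mul]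

/-- The extra sign from passing the outer modes is exactly the change of `relSign` when `k` is
filled. -/
theorem psi_fockEmbed (k : ℤ) (v : Fock K) :
    psi K (ι k) (fockEmbed K hι M v) = fockEmbed K hι M (psi K k v) := by
  classical
  induction v using Finsupp.induction_linear with
  | zero => simp
  | add f g hf hg => simp only [map_add, hf, hg]
  | single T a =>
    rw [fockEmbed_single, psi_single, psi_single, Maya.apply_mem_embed]
    split_ifs with h
    · simp
    · rw [fockEmbed_single, Maya.embed_fill, Maya.relSign_fill _ _ h, Maya.numAbove_embed,
        outerSign]
      push_cast
      congr 1
      ring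

theorem psiStar_fockEmbed (k : ℤ) (v : Fock K) :
    psiStar K (ι k) (fockEmbed K hι M v) = fockEmbed K hι M (psiStar K k v) := by
  classical
  induction v using Finsupp.induction_linear with
  | zero => simp
  | add f g hf hg => simp only [map_add, hf, hg]
  | single T a =>
    rw [fockEmbed_single, psiStar_single, psiStar_single, Maya.apply_mem_embed]
    split_ifs with h
    · rw [fockEmbed_single, Maya.embed_clear, Maya.relSign_clear _ _ h, Maya.numAbove_embed,
        outerSign]
      push_cast
      congr 1
      ring
    · simp

/-- A bilinear supported on the range of `ι` restricts along the embedding. -/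
theorem bilinear_fockEmbed {c c' : ℤ → K} {m m' : ℤ} (hm : m ≠ 0) (hm' : m' ≠ 0)
    (hc : ∀ x ∉ Set.range ι, c x = 0) (hcc' : ∀ k, c (ι k) = c' k)
    (hmm' : ∀ k, ι k + m = ι (k + m')) (v : Fock K) :
    bilinear c m (fockEmbed K hι M v) = fockEmbed K hι M (bilinear c' m' v) := by
  rw [bilinear_apply c hm, bilinear_apply c' hm']
  have hsub : (Function.support fun x =>
      c x • psi K x (psiStar K (x + m) (fockEmbed K hι M v))) ⊆ Set.range ι := by
    intro x hx
    by_contra h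
    exact hx (by simp [hc x h])
  rw [finsum_eq_finsum_comp hι.injective hsub]
  refine Eq.trans (finsum_congr fun k => ?_) ((fockEmbed K hι M).toAddMonoidHom.map_finsum
    (finite_support_bilinear_apply c' hm' v)).symm
  rw [hcc', hmm', psiStar_fockEmbed, psi_fockEmbed]
  exact (map_smul (fockEmbed K hι M) _ _).symm

theorem fockEmbed_ket {N n : ℤ} (h : ∀ k, ι k < N ↔ k < n) :
    fockEmbed K hι (Maya.vac N) (ket K n) =
      ((((Maya.vac n).relSign (outerSign ι (Maya.vac N)) : ℤˣ) : ℤ) : K) • ket K N := by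
  rw [ket, fockEmbed_single, (Maya.embed_vac_iff hι _ h).2 rfl, ket, Finsupp.smul_single,
    smul_eq_mul, one_mul, mul_one]

theorem bra_fockEmbed {N n : ℤ} (h : ∀ k, ι k < N ↔ k < n) (v : Fock K) :
    bra K N (fockEmbed K hι (Maya.vac N) v) =
      (((Maya.vac n).relSign (outerSign ι (Maya.vac N)) : ℤˣ) : ℤ) * bra K n v := by
  classical
  induction v using Finsupp.induction_linear with
  | zero => simp
  | add f g hf hg => simp only [map_add, hf, hg, mul_add]
  | single T a =>
    rw [fockEmbed_single]
    simp only [bra, Finsupp.lapply_apply, Finsupp.single_apply, Maya.embed_vac_iff hι T h]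
    split_ifs with hT
    · rw [hT, mul_comm]
    · simp

/-- The embedding multiplies the vacuum by a sign, and the dual vacuum picks up the same sign, so it
cancels. -/
theorem vev_eq_of_intertwines {σ : Type*} {f g : MvPowerSeries σ (Module.End K (Fock K))}
    {N n : ℤ} (h : ∀ k, ι k < N ↔ k < n)
    (hfg : Intertwines (fockEmbed K hι (Maya.vac N)) f g) : vev K N g = vev K n f := by
  ext e
  rw [coeff_vev, coeff_vev]
  have h1 := congrArg (bra K N) (hfg e (ket K n))
  rw [fockEmbed_ket hι h, bra_fockEmbed hι h, map_smul, map_smul, smul_eq_mul] at h1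
  refine mul_left_cancel₀ ?_ h1
  rcases Int.units_eq_one_or ((Maya.vac n).relSign (outerSign ι (Maya.vac N))) with h2 | h2 <;>
    simp [h2]

end Embedding

-- Series of operators in the times

section OperatorSeries

open MvPowerSeries

variable {K : Type*} [Field K] {σ : Type*}

/-- Every monomial occurs in only finitely many of the times. -/
def LocallyFinite (t : ℕ+ → MvPowerSeries σ K) : Prop := ∀ e, {m | coeff e (t m) ≠ 0}.Finite

theorem coeff_opSeries (O : ℕ+ → Module.End K (Fock K)) (t : ℕ+ → MvPowerSeries σ K)
    (e : σ →₀ ℕ) : coeff e (opSeries O t) = ∑ᶠ m : ℕ+, coeff e (t m) • O m := rfl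

/-- A monomial equals at most one of the distinct indeterminates. -/
theorem locallyFinite_X {ι : ℕ+ → σ} (hι : Function.Injective ι) :
    LocallyFinite fun m => (X (ι m) : MvPowerSeries σ K) := by
  classical
  intro e
  refine Set.Subsingleton.finite fun a ha b hb => hι ?_
  rw [Set.mem_ofPred_eq, coeff_X] at ha hb
  have ha' := by_contra fun h => ha (if_neg h)
  have hb' := by_contra fun h => hb (if_neg h)
  exact Finsupp.single_left_injective one_ne_zero (ha'.symm.trans hb')

theorem noConstTerm_opSeries_X (O : ℕ+ → Module.End K (Fock K)) (ι : ℕ+ → σ) :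
    NoConstTerm (opSeries O fun m => (X (ι m) : MvPowerSeries σ K)) := by
  rw [NoConstTerm, coeff_opSeries]
  simp

variable {t : ℕ+ → MvPowerSeries σ K}

theorem LocallyFinite.finite_support_smul (ht : LocallyFinite t)
    (O : ℕ+ → Module.End K (Fock K)) (e : σ →₀ ℕ) :
    (Function.support fun m => coeff e (t m) • O m).Finite :=
  (ht e).subset fun m hm h => hm (by simp [h])

theorem opSeries_timesPow (O : ℕ+ → Module.End K (Fock K)) (p : ℕ+) :
    opSeries O (timesPow p t) = opSeries (fun m => O (p * m)) t := by
  ext1 e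
  rw [coeff_opSeries, coeff_opSeries, finsum_eq_finsum_comp (mul_right_injective p)]
  · refine finsum_congr fun m => ?_
    have h : PNat.divExact (p * m) p = m :=
      mul_left_cancel (PNat.mul_div_exact (PNat.dvd_iff.2 ⟨m, by simp⟩))
    rw [timesPow, if_pos ⟨m, by simp⟩, h]
  · intro m hm
    by_contra h
    refine hm ?_
    have hp : ¬(p : ℕ) ∣ m := fun hd => h ⟨PNat.divExact m p, PNat.mul_div_exact (PNat.dvd_iff.2 hd)⟩
    simp [timesPow, hp]

theorem opSeries_sum (ht : LocallyFinite t) {ι : Type*} (s : Finset ι)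
    (O : ι → ℕ+ → Module.End K (Fock K)) :
    opSeries (fun m => ∑ i ∈ s, O i m) t = ∑ i ∈ s, opSeries (O i) t := by
  ext1 e
  simp_rw [map_sum, coeff_opSeries, Finset.smul_sum]
  exact finsum_sum_comm _ _ fun i _ => ht.finite_support_smul (O i) e

theorem opSeries_neg (O : ℕ+ → Module.End K (Fock K)) :
    opSeries (fun m => -O m) t = -opSeries O t := by
  ext1 e
  refine Eq.trans (finsum_congr fun m => ?_) (finsum_neg_distrib fun m => coeff e (t m) • O m)
  exact smul_neg (coeff e (t m)) (O m)

theorem coeffsIn_opSeries (ht : LocallyFinite t) {A : Subalgebra K (Module.End K (Fock K))}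
    {O : ℕ+ → Module.End K (Fock K)} (hO : ∀ m, O m ∈ A) : CoeffsIn A (opSeries O t) := by
  intro e
  rw [coeff_opSeries, finsum_eq_sum _ (ht.finite_support_smul O e)]
  exact sum_mem fun m _ => A.smul_mem (hO m) _

theorem finsum_end_apply {O : ℕ+ → Module.End K (Fock K)} (hO : (Function.support O).Finite)
    (v : Fock K) : (∑ᶠ m, O m) v = ∑ᶠ m, O m v :=
  (LinearMap.applyₗ (R := K) (M₂ := Fock K) v).toAddMonoidHom.map_finsum hO

theorem intertwines_opSeries (ht : LocallyFinite t) {Φ : Fock K →ₗ[K] Fock K}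
    {O O' : ℕ+ → Module.End K (Fock K)} (h : ∀ m v, O' m (Φ v) = Φ (O m v)) :
    Intertwines Φ (opSeries O t) (opSeries O' t) := by
  intro e v
  rw [coeff_opSeries, coeff_opSeries, finsum_end_apply (ht.finite_support_smul O' e),
    finsum_end_apply (ht.finite_support_smul O e)]
  refine Eq.trans (finsum_congr fun m => ?_) (Φ.toAddMonoidHom.map_finsum ?_).symm
  · rw [LinearMap.smul_apply, h]
    exact (map_smul Φ _ _).symm
  · exact (ht e).subset fun m hm h => hm (by simp [h])

/-- The vacuum expectation value of the product of exponentials factorizes for bilinears in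
mutually disjoint sets of modes. -/
theorem vev_fexp_sum_mul_fexp_sum [CharZero K] {ι : Type*} (D : ι → Set ℤ)
    {f g : ι → MvPowerSeries σ (Module.End K (Fock K))} (N : ℤ)
    (hf0 : ∀ i, NoConstTerm (f i)) (hg0 : ∀ i, NoConstTerm (g i))
    (hf : ∀ i, CoeffsIn (modeAlgebra K (D i)) (f i))
    (hg : ∀ i, CoeffsIn (modeAlgebra K (D i)) (g i))
    (s : Finset ι)
    (hf' : ∀ i ∈ s, ∀ j ∈ s, i ≠ j → CoeffsIn (coModeAlgebra K (D i)) (f j))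
    (hg' : ∀ i ∈ s, ∀ j ∈ s, i ≠ j → CoeffsIn (coModeAlgebra K (D i)) (g j)) :
    vev K N (fexp (K := K) (∑ i ∈ s, f i) * fexp (K := K) (∑ i ∈ s, g i)) =
      ∏ i ∈ s, vev K N (fexp (K := K) (f i) * fexp (K := K) (g i)) := by
  classical
  induction s using Finset.induction_on with
  | empty => rw [Finset.sum_empty, Finset.sum_empty, fexp_zero, mul_one, vev_one, Finset.prod_empty]
  | insert i s hi ih =>
    have hmem {j : ι} (hj : j ∈ s) : j ∈ insert i s := Finset.mem_insert_of_mem hj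
    -- The sum over the remaining indices stays in the commutant for `D i`, so the index `i` can be
    -- split off by `vev_mul`.
    have hfs : CoeffsIn (coModeAlgebra K (D i)) (∑ j ∈ s, f j) :=
      CoeffsIn.sum fun j hj =>
        hf' i (Finset.mem_insert_self i s) j (hmem hj) (by rintro rfl; exact hi hj)
    have hgs : CoeffsIn (coModeAlgebra K (D i)) (∑ j ∈ s, g j) :=
      CoeffsIn.sum fun j hj =>
        hg' i (Finset.mem_insert_self i s) j (hmem hj) (by rintro rfl; exact hi hj)
    rw [Finset.sum_insert hi, Finset.sum_insert hi, Finset.prod_insert hi,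
      ← ih (fun a ha b hb => hf' a (hmem ha) b (hmem hb))
        (fun a ha b hb => hg' a (hmem ha) b (hmem hb)),
      fexp_add_mul_fexp_add (hf0 i) (hg0 i) (NoConstTerm.sum fun j _ => hf0 j)
        (NoConstTerm.sum fun j _ => hg0 j) (hf i) (hg i) hfs hgs]
    exact vev_mul ((hf i).fexp.mul (hg i).fexp) (hfs.fexp.mul hgs.fexp) N

end OperatorSeries

-- Colours: residue classes of modes modulo `p`

section Coloring

open MvPowerSeries

variable {K : Type*} [Field K]

/-- The mode of colour `c` with number `k`. -/
def colorMode (p : ℕ+) (c : ℕ) (k : ℤ) : ℤ := k * (p : ℕ) + c - 1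

theorem colorMode_strictMono (p : ℕ+) (c : ℕ) : StrictMono (colorMode p c) := by
  intro a b h
  have hp : (0 : ℤ) < (p : ℕ) := by exact_mod_cast p.pos
  have := mul_lt_mul_of_pos_right h hp
  unfold colorMode
  lia

theorem colorMode_add (p : ℕ+) (c : ℕ) (k m : ℤ) :
    colorMode p c k + (p : ℕ) * m = colorMode p c (k + m) := by
  unfold colorMode
  ring

theorem mem_range_colorMode_add (p : ℕ+) (c : ℕ) (x m : ℤ) :
    x + (p : ℕ) * m ∈ Set.range (colorMode p c) ↔ x ∈ Set.range (colorMode p c) := by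
  constructor
  · rintro ⟨k, hk⟩
    exact ⟨k - m, by rw [sub_eq_add_neg, ← colorMode_add, hk]; ring⟩
  · rintro ⟨k, rfl⟩
    exact ⟨k + m, (colorMode_add p c k m).symm⟩

theorem existsUnique_color (p : ℕ+) (x : ℤ) :
    ∃! c, c ∈ Finset.Icc 1 (p : ℕ) ∧ x ∈ Set.range (colorMode p c) := by
  have hp : (0 : ℤ) < (p : ℕ) := by exact_mod_cast p.pos
  have h0 := Int.emod_nonneg x hp.ne'
  have h1 := Int.emod_lt_of_pos x hp
  have h2 := Int.emod_add_mul_ediv x (p : ℕ)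
  -- Colours run from `1` to `p`, hence the shift of the residue by one.
  refine ⟨(x % (p : ℕ)).toNat + 1, ⟨by rw [Finset.mem_Icc]; lia, x / (p : ℕ), ?_⟩, ?_⟩
  · unfold colorMode
    push_cast
    rw [Int.toNat_of_nonneg h0]
    linarith
  · rintro c ⟨hc, k, rfl⟩
    rw [Finset.mem_Icc] at hc
    have : colorMode p c k % (p : ℕ) = c - 1 := by
      rw [colorMode, show k * ((p : ℕ) : ℤ) + c - 1 = (c - 1) + k * (p : ℕ) by ring,
        Int.add_mul_emod_self_right, Int.emod_eq_of_lt (by lia) (by lia)]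
    rw [this]
    lia

/-- As `1 ≤ c ≤ p` and `i ≤ p`, the inequality holds for `k < n` and fails for `k > n`; at `k = n`
it reads `c ≤ i`. This produces the two products in the result. -/
theorem colorMode_lt_iff (p : ℕ+) {c i : ℕ} (hc : c ∈ Finset.Icc 1 (p : ℕ)) (hip : i ≤ (p : ℕ))
    (n k : ℤ) : colorMode p c k < n * (p : ℕ) + i ↔ k < if c ≤ i then n + 1 else n := by
  rw [Finset.mem_Icc] at hc
  have hp : (0 : ℤ) < (p : ℕ) := by exact_mod_cast p.pos
  unfold colorMode
  constructor
  · intro h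
    by_contra! hk
    split_ifs at hk with hci
    · have := mul_le_mul_of_nonneg_right hk hp.le
      rw [add_mul, one_mul] at this
      lia
    · have := mul_le_mul_of_nonneg_right hk hp.le
      lia
  · intro hk
    split_ifs at hk with hci
    · have := mul_le_mul_of_nonneg_right (Int.lt_add_one_iff.1 hk) hp.le
      lia
    · have := mul_le_mul_of_nonneg_right (Int.add_one_le_of_lt hk) hp.le
      rw [add_mul, one_mul] at this
      lia

/-- The part of a coefficient function that is supported on the modes of colour `c`. -/
def colorPart (p : ℕ+) (c : ℕ) (a : ℤ → K) : ℤ → K := (Set.range (colorMode p c)).indicator a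

theorem sum_colorPart (p : ℕ+) (a : ℤ → K) :
    ∑ c ∈ Finset.Icc 1 (p : ℕ), colorPart p c a = a := by
  ext x
  obtain ⟨c, ⟨hc, hx⟩, huniq⟩ := existsUnique_color p x
  rw [Finset.sum_apply, Finset.sum_eq_single_of_mem c hc fun d hd hdc => ?_]
  · exact Set.indicator_of_mem hx a
  · exact Set.indicator_of_notMem (fun h => hdc (huniq d ⟨hd, h⟩)) a

/-- A shift by a multiple of `p` preserves the colour, so both fermions of each term have colour
`c`. -/
theorem colorPart_bilinear_mem_modeAlgebra (p : ℕ+) (c : ℕ) (a : ℤ → K) {m : ℤ} (hm : m ≠ 0) :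
    bilinear (colorPart p c a) ((p : ℕ) * m) ∈ modeAlgebra K (Set.range (colorMode p c)) := by
  refine bilinear_mem_modeAlgebra (mul_ne_zero (by exact_mod_cast p.ne_zero) hm) fun k hk => ?_
  have h := Set.mem_of_indicator_ne_zero hk
  exact ⟨h, (mem_range_colorMode_add p c k m).2 h⟩

theorem colorPart_bilinear_mem_coModeAlgebra (p : ℕ+) {c d : ℕ} (hc : c ∈ Finset.Icc 1 (p : ℕ))
    (hd : d ∈ Finset.Icc 1 (p : ℕ)) (hcd : c ≠ d) (a : ℤ → K) {m : ℤ} (hm : m ≠ 0) :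
    bilinear (colorPart p d a) ((p : ℕ) * m) ∈ coModeAlgebra K (Set.range (colorMode p c)) := by
  refine bilinear_mem_coModeAlgebra (mul_ne_zero (by exact_mod_cast p.ne_zero) hm) fun k hk => ?_
  have h := Set.mem_of_indicator_ne_zero hk
  have h' : k ∉ Set.range (colorMode p c) := fun h' =>
    hcd ((existsUnique_color p k).unique ⟨hc, h'⟩ ⟨hd, h⟩)
  exact ⟨h', fun h'' => h' ((mem_range_colorMode_add p c k m).1 h'')⟩

theorem opH_mul (p m : ℕ+) : opH K (p * m) =
    ∑ c ∈ Finset.Icc 1 (p : ℕ), bilinear (colorPart p c fun _ => (1 : K)) ((p : ℕ) * (m : ℤ)) := by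
  rw [← bilinear_sum _ _ (by positivity), sum_colorPart, opH]
  push_cast
  rfl

/-- The coefficients of `-A_m`. -/
def weight (r : ℤ → K) (m : ℕ) (k : ℤ) : K := ∏ j ∈ Finset.range m, r (k - j)

theorem neg_opA (r : ℤ → K) (m : ℕ+) : -opA r m = bilinear (weight r m) (-(m : ℤ)) :=
  neg_neg (bilinear (weight r m) (-(m : ℤ)) : Module.End K (Fock K))

theorem neg_opA_mul (r : ℤ → K) (p m : ℕ+) : -opA r (p * m) =
    ∑ c ∈ Finset.Icc 1 (p : ℕ),
      bilinear (colorPart p c (weight r (p * m : ℕ))) ((p : ℕ) * -(m : ℤ)) := by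
  rw [← bilinear_sum _ _ (by simp), sum_colorPart, neg_opA]
  push_cast
  rw [mul_neg]

/-- The `pm` consecutive factors fall into `m` blocks of length `p`; the block with index `j` is `R`
at the mode of colour `c` and number `k - j`. -/
theorem weight_mul_colorMode (r : ℤ → K) (p : ℕ+) (c m : ℕ) (k : ℤ) :
    weight r (p * m) (colorMode p c k) = weight (colorR r p c) m k := by
  unfold weight colorR bigR
  induction m with
  | zero => simp
  | succ m ih =>
    rw [Finset.prod_range_succ, ← ih, mul_add, mul_one, Finset.prod_range_add]
    congr 1
    refine Finset.prod_congr rfl fun j _ => congrArg r ?_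
    unfold colorMode
    push_cast
    ring

theorem tau_eq_vev (r : ℤ → K) (n : ℤ) {σ : Type*} (t ts : ℕ+ → MvPowerSeries σ K) :
    tau r n t ts = vev K n (fexp (K := K) (opSeries (opH K) t) *
      fexp (K := K) (opSeries (fun m => -opA r m) ts)) := by
  rw [opSeries_neg]
  rfl

/-- Under the relabelling `k ↦ kp + c - 1`, a shift by `pm` becomes a shift by `m`, so the bilinears
of colour `c` restrict to `H_m` and to `-A_m` for `r^{(c)}`. -/
theorem vev_color_eq_tau (r : ℤ → K) {p : ℕ+} {c : ℕ} {N n : ℤ}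
    (h : ∀ k, colorMode p c k < N ↔ k < n) {σ : Type*} {t ts : ℕ+ → MvPowerSeries σ K}
    (ht : LocallyFinite t) (hts : LocallyFinite ts) :
    vev K N
      (fexp (K := K) (opSeries (fun m => bilinear (colorPart p c fun _ => 1)
          ((p : ℕ) * (m : ℤ))) t) *
        fexp (K := K) (opSeries (fun m => bilinear (colorPart p c (weight r (p * m : ℕ)))
          ((p : ℕ) * -(m : ℤ))) ts)) = tau (colorR r p c) n t ts := by
  rw [tau_eq_vev]
  refine vev_eq_of_intertwines (colorMode_strictMono p c) h
    ((intertwines_opSeries ht fun m v => ?_).fexp.mul (intertwines_opSeries hts fun m v => ?_).fexp)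
  · exact bilinear_fockEmbed _ _ (by positivity) (by positivity)
      (fun x hx => Set.indicator_of_notMem hx _) (fun k => Set.indicator_of_mem (Set.mem_range_self k) _)
      (fun k => colorMode_add p c k m) v
  · rw [neg_opA]
    exact bilinear_fockEmbed _ _ (by simp) (by simp)
      (fun x hx => Set.indicator_of_notMem hx _)
      (fun k => (Set.indicator_of_mem (Set.mem_range_self k) _).trans (weight_mul_colorMode r p c m k))
      (fun k => colorMode_add p c k _) v

end Coloring

end HypTau
end

-- Assembly of the product formula

theorem mainTheorem3 {K : Type*} [Field K] [CharZero K] (r : ℤ → K) (p : ℕ+) (n : ℤ)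
    (i : ℕ) (hi : 1 ≤ i) (hip : i ≤ (p : ℕ)) :
    HypTau.tau r (n * (p : ℕ) + i)
        (HypTau.timesPow p (HypTau.timeT K)) (HypTau.timesPow p (HypTau.timeTs K)) =
      (∏ m ∈ Finset.Icc 1 i,
          HypTau.tau (HypTau.colorR r p m) (n + 1) (HypTau.timeT K) (HypTau.timeTs K)) *
        ∏ m ∈ Finset.Icc (i + 1) (p : ℕ),
          HypTau.tau (HypTau.colorR r p m) n (HypTau.timeT K) (HypTau.timeTs K) := by
  let H : ℕ → MvPowerSeries (ℕ+ ⊕ ℕ+) (Module.End K (HypTau.Fock K)) := fun c =>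
    HypTau.opSeries (fun m => HypTau.bilinear (HypTau.colorPart p c fun _ => 1)
      ((p : ℕ) * (m : ℤ))) (HypTau.timeT K)
  let A : ℕ → MvPowerSeries (ℕ+ ⊕ ℕ+) (Module.End K (HypTau.Fock K)) := fun c =>
    HypTau.opSeries (fun m => HypTau.bilinear (HypTau.colorPart p c (HypTau.weight r (p * m : ℕ)))
      ((p : ℕ) * -(m : ℤ))) (HypTau.timeTs K)
  have ht : HypTau.LocallyFinite (HypTau.timeT K) := HypTau.locallyFinite_X Sum.inl_injective
  have hts : HypTau.LocallyFinite (HypTau.timeTs K) := HypTau.locallyFinite_X Sum.inr_injective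
  let D : ℕ → Set ℤ := fun c => Set.range (HypTau.colorMode p c)
  have hH0 (c : ℕ) : HypTau.NoConstTerm (H c) := HypTau.noConstTerm_opSeries_X _ Sum.inl
  have hA0 (c : ℕ) : HypTau.NoConstTerm (A c) := HypTau.noConstTerm_opSeries_X _ Sum.inr
  have hHD (c : ℕ) : HypTau.CoeffsIn (HypTau.modeAlgebra K (D c)) (H c) :=
    HypTau.coeffsIn_opSeries ht fun m =>
      HypTau.colorPart_bilinear_mem_modeAlgebra p c _ (by positivity)
  have hAD (c : ℕ) : HypTau.CoeffsIn (HypTau.modeAlgebra K (D c)) (A c) :=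
    HypTau.coeffsIn_opSeries hts fun m =>
      HypTau.colorPart_bilinear_mem_modeAlgebra p c _ (by simp)
  have hHD' : ∀ c ∈ Finset.Icc 1 (p : ℕ), ∀ d ∈ Finset.Icc 1 (p : ℕ), c ≠ d →
      HypTau.CoeffsIn (HypTau.coModeAlgebra K (D c)) (H d) := fun c hc d hd hcd =>
    HypTau.coeffsIn_opSeries ht fun m =>
      HypTau.colorPart_bilinear_mem_coModeAlgebra p hc hd hcd _ (by positivity)
  have hAD' : ∀ c ∈ Finset.Icc 1 (p : ℕ), ∀ d ∈ Finset.Icc 1 (p : ℕ), c ≠ d →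
      HypTau.CoeffsIn (HypTau.coModeAlgebra K (D c)) (A d) := fun c hc d hd hcd =>
    HypTau.coeffsIn_opSeries hts fun m =>
      HypTau.colorPart_bilinear_mem_coModeAlgebra p hc hd hcd _ (by simp)
  have key := HypTau.vev_fexp_sum_mul_fexp_sum D (n * (p : ℕ) + i) hH0 hA0 hHD hAD
    (Finset.Icc 1 (p : ℕ)) hHD' hAD'
  have hHs : HypTau.opSeries (HypTau.opH K) (HypTau.timesPow p (HypTau.timeT K)) =
      ∑ c ∈ Finset.Icc 1 (p : ℕ), H c := by
    rw [HypTau.opSeries_timesPow, funext (HypTau.opH_mul p)]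
    exact HypTau.opSeries_sum ht _ _
  have hAs : HypTau.opSeries (fun m => -HypTau.opA r m)
      (HypTau.timesPow p (HypTau.timeTs K)) = ∑ c ∈ Finset.Icc 1 (p : ℕ), A c := by
    rw [HypTau.opSeries_timesPow, funext (HypTau.neg_opA_mul r p)]
    exact HypTau.opSeries_sum hts _ _
  rw [HypTau.tau_eq_vev, hHs, hAs, key]
  -- The charge in the factor of colour `c` is the one that the vacuum of charge `np + i` induces on
  -- that colour.
  have hτ (c : ℕ) (hc : c ∈ Finset.Icc 1 (p : ℕ)) :
      HypTau.vev K (n * (p : ℕ) + i) (HypTau.fexp (K := K) (H c) * HypTau.fexp (K := K) (A c)) =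
        HypTau.tau (HypTau.colorR r p c) (if c ≤ i then n + 1 else n) (HypTau.timeT K)
          (HypTau.timeTs K) :=
    HypTau.vev_color_eq_tau r (HypTau.colorMode_lt_iff p hc hip n) ht hts
  rw [Finset.prod_congr rfl hτ]
  have hun : Finset.Icc 1 (p : ℕ) = Finset.Icc 1 i ∪ Finset.Icc (i + 1) (p : ℕ) := by
    ext c
    simp only [Finset.mem_union, Finset.mem_Icc]
    lia
  have hdisj : Disjoint (Finset.Icc 1 i) (Finset.Icc (i + 1) (p : ℕ)) := by
    rw [Finset.disjoint_left]
    intro c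
    simp only [Finset.mem_Icc]
    lia
  rw [hun, Finset.prod_union hdisj]
  refine congrArg₂ (· * ·) (Finset.prod_congr rfl fun c hc => ?_)
    (Finset.prod_congr rfl fun c hc => ?_)
  · rw [if_pos (Finset.mem_Icc.1 hc).2]
  · rw [if_neg (by rw [Finset.mem_Icc] at hc; lia)]
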